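/- For integers $0\le k\le N$ let $A_i(k,N)$ be the universal unital C$^*$-algebra generated by elements $u_{lj}$ ($1\le l\le N$, $1\le j\le k$) such that every $u_{lj}$ is an orthogonal projection, $\sum_{l=1}^{N}u_{lj}=1$ for every $j$, and $u_{lj}u_{l'j'}=0$ whenever $j<j'$ and $l\ge l'$. For $m\ge 0$ let $NC(m)$ be the set of non-crossing partitions of $\{1,\dots,m\}$, ordered by refinement ($\sigma\le\pi$ if every block of $\sigma$ is contained in a block of $\pi$), let $\mu_m$ be the Möbius function of the poset $NC(m)$, let $|\sigma|$ be the number of blocks of $\sigma$, let $\ker\mathbf i$ be the partition of $\{1,\dots,m\}$ whose blocks are the classes of $s\sim t\Leftrightarrow i_s=i_t$, and let $\pi\wedge\ker\mathbf i$ be the meet in the lattice of all partitions. Let $k\ge 0$ and $n\ge 1$ be integers. Then there is a state $\psi_{k,n}$ on $A_i(k,kn)$ such that: (1) for all $m\ge 0$, $1\le l_1,\dots,l_m\le kn$ and $1\le j_1,\dots,j_m\le k$, $$\psi_{k,n}(u_{l_1j_1}\cdots u_{l_mj_m})=0$$ unless $(j_r-1)n<l_r\le j_rn$ for $r=1,\dots,m$;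 (2) for all $m\ge 0$, $1\le j_1,\dots,j_m\le k$ and $1\le i_1,\dots,i_m\le n$, $$\psi_{k,n}\bigl(u_{((j_1-1)n+i_1)j_1}\cdots u_{((j_m-1)n+i_m)j_m}\bigr)=\sum_{\substack{\pi\in NC(m)\\ \pi\le\ker\mathbf j}}\ \sum_{\substack{\sigma\in NC(m)\\ \sigma\le\pi\wedge\ker\mathbf i}}\mu_m(\sigma,\pi)\,n^{-|\sigma|};$$ (3) there are a unital C$^*$-algebra $A$ with a state $\varphi$, projections $p_{ij}\in A$ ($1\le i\le n$, $1\le j\le k$) with $\sum_{i=1}^n p_{ij}=1$ for every $j$ and $\varphi(p_{ij})=1/n$ for all $i,j$, such that the $k$ families $\{p_{1j},\dots,p_{nj}\}$, $j=1,\dots,k$, are freely independent with respect to $\varphi$, and a unital $*$-homomorphism $h:A_i(k,kn)\to A$ with $h(u_{((j-1)n+i)j})=p_{ij}$ for all $i,j$ and $h(u_{lj})=0$ unless $(j-1)n<l\le jn$, such that $\psi_{k,n}=\varphi\circ h$. Here the families are freely independent if $\varphi(a_1\cdots a_m)=0$ whenever $m\ge 1$, each $a_r$ lies in the unital $*$-algebra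 generated by the family of index $j_r$, $\varphi(a_r)=0$ for all $r$, and $j_r\ne j_{r+1}$ for all $r<m$. -/

import Mathlib

open scoped ENNReal

noncomputable section

namespace QuantumIncreasing

/-! ## The universal C⋆-algebra of quantum increasing sequences

Rows and columns are numbered from `0`. -/

/-- The defining relations of the quantum increasing sequence space on `k` columns and `n` rows:
every entry is an orthogonal projection, every column is a partition of unity, and
`u i j * u i' j' = 0` whenever `j < j'` and `i ≥ i'`. -/
structure IsIncreasingMatrix {k n : ℕ} {B : Type} [CStarAlgebra B] (u : Fin n → Fin k → B) :
    Prop where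
  isStarProjection : ∀ i j, IsStarProjection (u i j)
  sum_eq_one : ∀ j, ∑ i, u i j = 1
  mul_eq_zero : ∀ i i' j j', j < j' → i' ≤ i → u i j * u i' j' = 0

/-- A nonzero unital C⋆-algebra with a matrix of elements that satisfies the relations. -/
structure Model (k n : ℕ) where
  carrier : Type
  [cstar : CStarAlgebra carrier]
  [nontriv : Nontrivial carrier]
  u : Fin n → Fin k → carrier
  rel : IsIncreasingMatrix u

attribute [instance] Model.cstar Model.nontriv

/-- Evaluation of noncommutative polynomials at a matrix of elements. -/
def evalPoly {k n : ℕ} {B : Type} [CStarAlgebra B] (u : Fin n → Fin k → B) :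
    FreeAlgebra ℂ (Fin n × Fin k) →ₐ[ℂ] B :=
  FreeAlgebra.lift ℂ (fun x => u x.1 x.2)

/-- The seminorm on noncommutative polynomials in the generators that a model induces. -/
def Model.seminorm {k n : ℕ} (R : Model k n) (x : FreeAlgebra ℂ (Fin n × Fin k)) : ℝ :=
  ‖evalPoly R.u x‖

/-- The set of all seminorms induced by models.  Two models induce the same seminorm exactly when
there is an isomorphism, matching generators, between the C⋆-subalgebras that their entries
generate, so this set indexes the models up to isomorphism. -/
def ModelClass (k n : ℕ) : Type :=
  {N : FreeAlgebra ℂ (Fin n × Fin k) → ℝ // ∃ R : Model k n, R.seminorm = N}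

/-- A model in a given class. -/
def ModelClass.model {k n : ℕ} (N : ModelClass k n) : Model k n := N.2.choose

theorem ModelClass.model_seminorm {k n : ℕ} (N : ModelClass k n) : N.model.seminorm = N.1 :=
  N.2.choose_spec

/-- The C⋆-algebra of bounded families in the product of all models. -/
abbrev ModelProduct (k n : ℕ) : Type := lp (fun N : ModelClass k n => N.model.carrier) ∞

instance (k n : ℕ) : CStarAlgebra (ModelProduct k n) where

/-- The family of the `(i, j)` entries of all models. -/
def diagonalGen {k n : ℕ} (i : Fin n) (j : Fin k) : ModelProduct k n :=
  ⟨fun N => N.model.u i j, memℓp_infty ⟨1, by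
    rintro _ ⟨N, rfl⟩
    exact (N.model.rel.isStarProjection i j).norm_le⟩⟩

/-- The closed unital ⋆-subalgebra generated by the diagonal families. -/
abbrev generatedSubalgebra (k n : ℕ) : StarSubalgebra ℂ (ModelProduct k n) :=
  (StarAlgebra.adjoin ℂ
    (Set.range fun x : Fin n × Fin k => diagonalGen x.1 x.2)).topologicalClosure

instance (k n : ℕ) : IsClosed ((generatedSubalgebra k n : StarSubalgebra ℂ (ModelProduct k n)) :
    Set (ModelProduct k n)) :=
  StarSubalgebra.isClosed_topologicalClosure _

/-- The quantum increasing sequence space `A_i(k,n)`: the universal unital C⋆-algebra generated by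
an `n × k` matrix that satisfies `IsIncreasingMatrix`.  It is built as the C⋆-algebra generated by
the entries in the product of all models; its universal property is `Ai.existsUnique_lift`. -/
def Ai (k n : ℕ) : Type := generatedSubalgebra k n

instance (k n : ℕ) : CStarAlgebra (Ai k n) :=
  inferInstanceAs (CStarAlgebra (generatedSubalgebra k n))

/-- The standard generators of `A_i(k,n)`. -/
def Ai.gen {k n : ℕ} (i : Fin n) (j : Fin k) : Ai k n :=
  ⟨diagonalGen i j, StarSubalgebra.le_topologicalClosure _
    (StarAlgebra.subset_adjoin ℂ _ ⟨(i, j), rfl⟩)⟩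

theorem diagonalGen_isIncreasingMatrix (k n : ℕ) :
    IsIncreasingMatrix (diagonalGen : Fin n → Fin k → ModelProduct k n) where
  isStarProjection i j :=
    ⟨Subtype.ext (funext fun N => (N.model.rel.isStarProjection i j).isIdempotentElem.eq),
      Subtype.ext (funext fun N => (N.model.rel.isStarProjection i j).isSelfAdjoint.star_eq)⟩
  sum_eq_one j := by
    refine Subtype.ext (funext fun N => ?_)
    rw [lp.coeFn_sum, Finset.sum_apply]
    exact N.model.rel.sum_eq_one j
  mul_eq_zero i i' j j' h h' :=
    Subtype.ext (funext fun N => N.model.rel.mul_eq_zero i i' j j' h h')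

theorem Ai.gen_isIncreasingMatrix (k n : ℕ) :
    IsIncreasingMatrix (Ai.gen : Fin n → Fin k → Ai k n) where
  isStarProjection i j :=
    ⟨Subtype.ext ((diagonalGen_isIncreasingMatrix k n).isStarProjection i j).isIdempotentElem.eq,
      Subtype.ext ((diagonalGen_isIncreasingMatrix k n).isStarProjection i j).isSelfAdjoint.star_eq⟩
  sum_eq_one j := by
    refine Subtype.ext ?_
    refine (map_sum (generatedSubalgebra k n).subtype _ _).trans ?_
    exact (diagonalGen_isIncreasingMatrix k n).sum_eq_one j
  mul_eq_zero i i' j j' h h' :=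
    Subtype.ext ((diagonalGen_isIncreasingMatrix k n).mul_eq_zero i i' j j' h h')

/-- The universal norm dominates the norm in every C⋆-algebra that satisfies the relations. -/
theorem norm_evalPoly_le {k n : ℕ} {B : Type} [CStarAlgebra B] {f : Fin n → Fin k → B}
    (hf : IsIncreasingMatrix f) (x : FreeAlgebra ℂ (Fin n × Fin k)) :
    ‖evalPoly f x‖ ≤ ‖evalPoly (diagonalGen : Fin n → Fin k → ModelProduct k n) x‖ := by
  rcases subsingleton_or_nontrivial B with hB | hB
  · rw [Subsingleton.elim (evalPoly f x) 0, norm_zero]; exact norm_nonneg _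
  let R : Model k n := { carrier := B, u := f, rel := hf }
  let N : ModelClass k n := ⟨R.seminorm, R, rfl⟩
  have h1 : ‖evalPoly f x‖ = ‖evalPoly N.model.u x‖ := (congrFun N.model_seminorm x).symm
  have h2 : ∀ y : FreeAlgebra ℂ (Fin n × Fin k),
      (evalPoly (diagonalGen : Fin n → Fin k → ModelProduct k n) y : ModelProduct k n) N
        = evalPoly N.model.u y := by
    intro y
    induction y using FreeAlgebra.induction with
    | grade0 r => simp only [AlgHom.commutes]; rfl
    | grade1 x => simp only [evalPoly, FreeAlgebra.lift_ι_apply]; rfl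
    | mul a b ha hb => simp only [map_mul, ← ha, ← hb]; rfl
    | add a b ha hb => simp only [map_add, ← ha, ← hb]; rfl
  rw [h1, ← h2]
  exact lp.norm_apply_le_norm ENNReal.top_ne_zero _ N

/-- The ⋆-algebra generated by a matrix of projections consists of noncommutative polynomials. -/
theorem exists_evalPoly_of_mem_adjoin {k n : ℕ} {B : Type} [CStarAlgebra B] {f : Fin n → Fin k → B}
    (hf : ∀ i j, star (f i j) = f i j) {b : B}
    (hb : b ∈ StarAlgebra.adjoin ℂ (Set.range fun x : Fin n × Fin k => f x.1 x.2)) :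
    ∃ x, evalPoly f x = b := by
  induction hb using Algebra.adjoin_induction with
  | mem y hy =>
    rcases hy with ⟨p, rfl⟩ | hy
    · exact ⟨FreeAlgebra.ι ℂ p, by simp [evalPoly]⟩
    · obtain ⟨p, hp⟩ := hy
      refine ⟨FreeAlgebra.ι ℂ p, ?_⟩
      rw [← star_star y, ← hp]
      simp [evalPoly, hf]
  | algebraMap r => exact ⟨algebraMap ℂ _ r, AlgHom.commutes _ _⟩
  | add a b _ _ ha hb =>
    obtain ⟨x, rfl⟩ := ha
    obtain ⟨y, rfl⟩ := hb
    exact ⟨x + y, map_add _ _ _⟩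
  | mul a b _ _ ha hb =>
    obtain ⟨x, rfl⟩ := ha
    obtain ⟨y, rfl⟩ := hb
    exact ⟨x * y, map_mul _ _ _⟩

/-- The universal property of `A_i(k,n)`. -/
theorem Ai.existsUnique_lift {k n : ℕ} {B : Type} [CStarAlgebra B] {f : Fin n → Fin k → B}
    (hf : IsIncreasingMatrix f) :
    ∃! h : Ai k n →⋆ₐ[ℂ] B, ∀ i j, h (Ai.gen i j) = f i j := by
  let d : Fin n → Fin k → ModelProduct k n := diagonalGen
  have hd : IsIncreasingMatrix d := diagonalGen_isIncreasingMatrix k n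
  let g : Fin n → Fin k → ModelProduct k n × B := fun i j => (d i j, f i j)
  have hg : ∀ i j, star (g i j) = g i j := fun i j =>
    Prod.ext (hd.isStarProjection i j).isSelfAdjoint.star_eq
      (hf.isStarProjection i j).isSelfAdjoint.star_eq
  let S : StarSubalgebra ℂ (ModelProduct k n × B) :=
    StarAlgebra.adjoin ℂ (Set.range fun x : Fin n × Fin k => g x.1 x.2)
  let G := S.topologicalClosure
  have hpoly : ∀ x, evalPoly g x = (evalPoly d x, evalPoly f x) := by
    intro y
    induction y using FreeAlgebra.induction with
    | grade0 r => simp only [AlgHom.commutes]; rfl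
    | grade1 x => simp only [evalPoly, FreeAlgebra.lift_ι_apply]; rfl
    | mul a b ha hb => simp only [map_mul, ha, hb]; rfl
    | add a b ha hb => simp only [map_add, ha, hb]; rfl
  have hle : ∀ z ∈ G, ‖z.2‖ ≤ ‖z.1‖ := by
    intro z hz
    have hcl : IsClosed {z : ModelProduct k n × B | ‖z.2‖ ≤ ‖z.1‖} :=
      isClosed_le continuous_snd.norm continuous_fst.norm
    refine (closure_minimal ?_ hcl) hz
    intro w hw
    obtain ⟨x, rfl⟩ := exists_evalPoly_of_mem_adjoin hg hw
    rw [hpoly]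
    exact norm_evalPoly_le hf x
  let p : G →⋆ₐ[ℂ] ModelProduct k n := (StarAlgHom.fst ℂ _ _).comp G.subtype
  have hiso : Isometry p := by
    refine AddMonoidHomClass.isometry_of_norm p fun z => ?_
    have : ‖(z : ModelProduct k n × B)‖ = ‖(z : ModelProduct k n × B).1‖ :=
      max_eq_left (hle _ z.2)
    exact this.symm
  have hGc : IsClosed (G : Set (ModelProduct k n × B)) := StarSubalgebra.isClosed_topologicalClosure _
  have : CompleteSpace G := hGc.completeSpace_coe
  have hrc : IsClosed (p.range : Set (ModelProduct k n)) := by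
    have hr := hiso.isClosedEmbedding.isClosed_range
    exact hr
  have hsub : generatedSubalgebra k n ≤ p.range := by
    refine StarSubalgebra.topologicalClosure_minimal ?_ hrc
    refine StarAlgebra.adjoin_le ?_
    rintro _ ⟨x, rfl⟩
    exact ⟨⟨g x.1 x.2, StarSubalgebra.le_topologicalClosure _
      (StarAlgebra.subset_adjoin ℂ _ ⟨x, rfl⟩)⟩, rfl⟩
  let e : G ≃⋆ₐ[ℂ] p.range :=
    StarAlgEquiv.ofBijective p.rangeRestrict
      ⟨fun a b h => hiso.injective (congrArg Subtype.val h), by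
        rintro ⟨_, a, rfl⟩
        exact ⟨a, rfl⟩⟩
  let h : generatedSubalgebra k n →⋆ₐ[ℂ] B :=
    ((StarAlgHom.snd ℂ _ _).comp G.subtype).comp
      ((e.symm : p.range →⋆ₐ[ℂ] G).comp (StarSubalgebra.inclusion hsub))
  have hh : ∀ i j, h (Ai.gen i j) = f i j := by
    intro i j
    let z : G := ⟨g i j, StarSubalgebra.le_topologicalClosure _
      (StarAlgebra.subset_adjoin ℂ _ ⟨(i, j), rfl⟩)⟩
    have hz : e.symm (StarSubalgebra.inclusion hsub (Ai.gen i j)) = z :=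
      (StarAlgEquiv.symm_apply_eq e).2 rfl
    exact congrArg (fun w : G => (w : ModelProduct k n × B).2) hz
  refine ⟨h, hh, fun h' hh' => ?_⟩
  have c1 : Continuous h' :=
    AddMonoidHomClass.continuous_of_bound h' 1 fun a => by
      rw [one_mul]
      exact NonUnitalStarAlgHom.norm_apply_le h' a
  let hA : Ai k n →⋆ₐ[ℂ] B := h
  have c2 : Continuous hA :=
    AddMonoidHomClass.continuous_of_bound hA 1 fun a => by
      rw [one_mul]
      exact NonUnitalStarAlgHom.norm_apply_le hA a
  refine StarAlgHom.ext_topologicalClosure (φ := h') (ψ := h) c1 c2 ?_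
  refine StarAlgHom.ext_adjoin fun x hx => ?_
  obtain ⟨y, hy⟩ := hx
  have hx' : StarSubalgebra.inclusion (StarSubalgebra.le_topologicalClosure _) x
      = (Ai.gen y.1 y.2 : generatedSubalgebra k n) := Subtype.ext hy.symm
  exact (congrArg h' hx').trans (((hh' y.1 y.2).trans (hh y.1 y.2).symm).trans
    (congrArg h hx').symm)

/-! ## States and free independence -/

open scoped ComplexOrder in
/-- A state on a unital C⋆-algebra: a unital positive linear functional. -/
structure IsState {A : Type} [CStarAlgebra A] (φ : A →ₗ[ℂ] ℂ) : Prop where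
  map_one : φ 1 = 1
  nonneg : ∀ a, 0 ≤ φ (star a * a)

/-- Families of elements are freely independent with respect to `φ` if `φ` vanishes on nonempty
alternating products of centered elements of the unital ⋆-algebras that the families generate. -/
def FreelyIndependent {A J : Type} [CStarAlgebra A] (φ : A →ₗ[ℂ] ℂ) (s : J → Set A) : Prop :=
  ∀ (m : ℕ) (j : Fin (m + 1) → J) (a : Fin (m + 1) → A),
    (∀ r : Fin m, j r.castSucc ≠ j r.succ) →
    (∀ r, a r ∈ StarAlgebra.adjoin ℂ (s (j r))) →
    (∀ r, φ (a r) = 0) →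
    φ (List.ofFn a).prod = 0

/-! ## Non-crossing partitions -/

/-- Partitions of the ordered set `Fin m`. -/
abbrev Part (m : ℕ) : Type := Finpartition (Finset.univ : Finset (Fin m))

/-- A partition is non-crossing if `s₁ < t₁ < s₂ < t₂` with `s₁, s₂` in a block `V` and `t₁, t₂` in
a block `W` forces `V = W`. -/
def IsNonCrossing {m : ℕ} (π : Part m) : Prop :=
  ∀ V ∈ π.parts, ∀ W ∈ π.parts, ∀ s₁ t₁ s₂ t₂ : Fin m,
    s₁ < t₁ → t₁ < s₂ → s₂ < t₂ → s₁ ∈ V → s₂ ∈ V → t₁ ∈ W → t₂ ∈ W → V = W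

/-- The poset `NC(m)` of non-crossing partitions, ordered by refinement. -/
abbrev NC (m : ℕ) : Type := {π : Part m // IsNonCrossing π}

instance (m : ℕ) : DecidableLE (Part m) := Classical.decRel _

instance (m : ℕ) : Fintype (NC m) := Fintype.ofFinite _

instance (m : ℕ) : LocallyFiniteOrder (NC m) := by
  classical
  exact Fintype.toLocallyFiniteOrder

/-- The partition `ker i`, whose blocks are the classes of `s ∼ t ↔ i s = i t`. -/
def kerPart {m : ℕ} {I : Type} (i : Fin m → I) : Part m :=
  letI : DecidableRel (Setoid.ker i).r := Classical.decRel _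
  Finpartition.ofSetoid (Setoid.ker i)

/-- The row of index `i` in the `j`-th block of `n` consecutive rows. -/
def blockRow {k n : ℕ} (j : Fin k) (i : Fin n) : Fin (k * n) :=
  ⟨j * n + i, by
    calc (j : ℕ) * n + i < j * n + n := Nat.add_lt_add_left i.isLt _
      _ = (j + 1) * n := (Nat.succ_mul _ _).symm
      _ ≤ k * n := Nat.mul_le_mul_right n j.isLt⟩

/-- The row `l` lies in the `j`-th block of `n` consecutive rows. -/
def InBlock {k n : ℕ} (l : Fin (k * n)) (j : Fin k) : Prop :=
  (j : ℕ) * n ≤ l ∧ (l : ℕ) < (j + 1) * n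

end QuantumIncreasing

end

open QuantumIncreasing

/-!
The free families live in the left regular representation of a free product: let `G` be the free
product of `k` copies of `ℤ/n`, represented on `ℓ²(G)` by left translations, and let `φ` be the
vector state of the point mass at `1`, so that `φ (U g)` is `1` for `g = 1` and `0` otherwise. The
`j`-th copy of `ℤ/n` spans a copy of its group algebra `ℂ[ℤ/n]`, which is generated by `n`
orthogonal projections of trace `1 / n` (`cyclicProj`). Placing the `j`-th family of projections in
the `j`-th block of `n` rows and zeros elsewhere satisfies the relations of `A_i(k, kn)`
(`isIncreasingMatrix_blockDiagonal`), which gives the homomorphism `h`, and `ψ = φ ∘ h`.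

What has to be computed are the joint moments in the copies of `ℂ[ℤ/n]`. Exchanging the two sums of
the moment-cumulant formula writes its right-hand side as `∑ c_j(σ) τ_σ(a)` over the non-crossing
`σ ≤ ker j` (`ncMoment`), where `τ_σ` is the product over the blocks of `σ` of the trace of the
product of the arguments in the block, and `c_j(σ) = ∑ μ(σ, π)` over the non-crossing `π` with
`σ ≤ π ≤ ker j`. By Möbius inversion, `c_j` is the only function all of whose sums over principal
upper sets of `{σ ≤ ker j}` equal `1` (`sum_upper_ncCoeff`, `eq_of_sum_upper_eq`). Hence the sums
`∑ c_j(σ) F(σ)` are compatible with every pullback of partitions that has a left adjoint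
(`sum_comp_upperAdjoint`). Two pullbacks are needed: along the injection that skips a point, and
along the surjection that identifies two adjacent points of the same colour. They show that a unit
may be removed from the arguments of `ncMoment` (`ncMoment_removeOne`) and that adjacent arguments
of the same colour may be multiplied (`ncMoment_merge`). Furthermore `ncMoment` vanishes on centered
arguments whose adjacent colours are distinct (`ncMoment_eq_zero`), because every non-crossing
`σ ≤ ker j` has a singleton block then (`exists_singleton_mem_parts`).

For group elements as arguments, the same three rules reduce a word in the free product to a reduced
word, which is `1` only if it is empty; so both sides of the formula agree (`ncMoment_group`), and
they agree on all of `ℂ[ℤ/n]` by multilinearity (`apply_prod_colourHom`). Free independence is a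
special case: it is the vanishing of `ncMoment` on centered arguments of alternating colours.
-/

noncomputable section

namespace QuantumIncreasing

/-! ### Sums over upper sets and Galois connections -/

section Poset

variable {P Q : Type} [Fintype P] [PartialOrder P] [DecidableLE P]
  [Fintype Q] [PartialOrder Q] [DecidableLE Q]

/-- A function on a finite poset is determined by its sums over principal upper sets. -/
theorem eq_of_sum_upper_eq {c d : P → ℂ}
    (h : ∀ p, ∑ q with p ≤ q, c q = ∑ q with p ≤ q, d q) : c = d := by
  classical
  funext p
  induction p using (wellFounded_gt (α := P)).induction with
  | _ p ih =>
    have split : ∀ e : P → ℂ, ∑ q with p ≤ q, e q = e p + ∑ q with p < q, e q := by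
      intro e
      rw [← Finset.sum_insert (by simp)]
      congr 1
      ext q
      simp [le_iff_eq_or_lt, eq_comm]
    have hp := h p
    rw [split, split, Finset.sum_congr rfl fun q hq => ih q (Finset.mem_filter.1 hq).2] at hp
    exact add_right_cancel hp

/-- If all sums of `c` and of `d` over principal upper sets equal `1`, then `c` is the push-forward
of `d` under every upper adjoint `u`: the sum of the push-forward over the elements above `p` is the
sum of `d` over the elements above `l p`. -/
theorem sum_comp_upperAdjoint {l : P → Q} {u : Q → P} (gc : GaloisConnection l u)
    {c : P → ℂ} {d : Q → ℂ} (hc : ∀ p, ∑ p' with p ≤ p', c p' = 1)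
    (hd : ∀ q, ∑ q' with q ≤ q', d q' = 1) (F : P → ℂ) :
    ∑ q, d q * F (u q) = ∑ p, c p * F p := by
  classical
  have key : (fun p => ∑ q with u q = p, d q) = c := by
    refine eq_of_sum_upper_eq fun p => ?_
    rw [hc, ← hd (l p)]
    simp only [Finset.sum_filter, gc p _]
    rw [← Finset.sum_filter, Finset.sum_comm]
    refine Finset.sum_congr rfl fun q _ => ?_
    rw [Finset.sum_ite_eq]
    simp
  rw [← key]
  simp_rw [Finset.sum_mul, Finset.sum_filter]
  rw [Finset.sum_comm]
  simp

end Poset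

/-! ### Non-crossing partitions as equivalence relations -/

/-- The equivalence relation on `Fin m` whose classes are the blocks of `σ`. -/
def Part.setoid {m : ℕ} (σ : Part m) : Setoid (Fin m) where
  r a b := b ∈ σ.part a
  iseqv :=
    ⟨fun a => σ.mem_part (Finset.mem_univ a),
      fun {a b} h => by
        rw [σ.mem_part_iff_part_eq_part (Finset.mem_univ _) (Finset.mem_univ _)] at h ⊢
        exact h.symm,
      fun {a b c} h h' => by
        rw [σ.mem_part_iff_part_eq_part (Finset.mem_univ _) (Finset.mem_univ _)] at h h' ⊢
        exact h'.trans h⟩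

theorem part_le_iff {m : ℕ} {σ π : Part m} :
    σ ≤ π ↔ ∀ a b, Part.setoid σ a b → Part.setoid π a b := by
  constructor
  · intro h a b hab
    obtain ⟨W, hW, hle⟩ := h (σ.part_mem.2 (Finset.mem_univ a))
    have ha : a ∈ W := hle (σ.mem_part (Finset.mem_univ a))
    change b ∈ π.part a
    rw [π.part_eq_of_mem hW ha]
    exact hle hab
  · intro h V hV
    obtain ⟨a, ha⟩ := σ.nonempty_of_mem_parts hV
    refine ⟨π.part a, π.part_mem.2 (Finset.mem_univ a), fun b hb => h a b ?_⟩
    change b ∈ σ.part a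
    rwa [σ.part_eq_of_mem hV ha]

/-- The partition of `Fin m` into the classes of an equivalence relation. -/
def partOfSetoid {m : ℕ} (s : Setoid (Fin m)) : Part m :=
  letI : DecidableRel s.r := Classical.decRel _
  Finpartition.ofSetoid s

@[simp] theorem setoid_partOfSetoid {m : ℕ} (s : Setoid (Fin m)) :
    Part.setoid (partOfSetoid s) = s := by
  let : DecidableRel s.r := Classical.decRel _
  ext a b
  exact Finpartition.mem_part_ofSetoid_iff_rel

theorem le_kerPart_iff {m : ℕ} {I : Type} {σ : Part m} {j : Fin m → I} :
    σ ≤ kerPart j ↔ ∀ a b, Part.setoid σ a b → j a = j b := by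
  rw [part_le_iff, show kerPart j = partOfSetoid (Setoid.ker j) from rfl, setoid_partOfSetoid]
  rfl

theorem isNonCrossing_iff {m : ℕ} {σ : Part m} :
    IsNonCrossing σ ↔ ∀ s₁ t₁ s₂ t₂ : Fin m, s₁ < t₁ → t₁ < s₂ → s₂ < t₂ →
      Part.setoid σ s₁ s₂ → Part.setoid σ t₁ t₂ → Part.setoid σ s₁ t₁ := by
  constructor
  · intro h s₁ t₁ s₂ t₂ h1 h2 h3 hs ht
    have := h (σ.part s₁) (σ.part_mem.2 (Finset.mem_univ _)) (σ.part t₁)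
      (σ.part_mem.2 (Finset.mem_univ _)) s₁ t₁ s₂ t₂ h1 h2 h3
      (σ.mem_part (Finset.mem_univ _)) hs (σ.mem_part (Finset.mem_univ _)) ht
    change t₁ ∈ σ.part s₁
    rw [this]
    exact σ.mem_part (Finset.mem_univ _)
  · intro h V hV W hW s₁ t₁ s₂ t₂ h1 h2 h3 hs₁ hs₂ ht₁ ht₂
    rw [← σ.part_eq_of_mem hV hs₁, ← σ.part_eq_of_mem hW ht₁] at *
    have := h s₁ t₁ s₂ t₂ h1 h2 h3 hs₂ ht₂
    exact ((σ.mem_part_iff_part_eq_part (Finset.mem_univ _) (Finset.mem_univ _)).1 this).symm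

/-! ### The coefficients of the moment-cumulant formula -/

/-- The poset of non-crossing partitions whose blocks lie in level sets of `j`. -/
abbrev NCBelow {m : ℕ} {J : Type} (j : Fin m → J) : Type := {σ : NC m // σ.1 ≤ kerPart j}

instance {m : ℕ} {J : Type} (j : Fin m → J) : Fintype (NCBelow j) := Fintype.ofFinite _

instance {m : ℕ} {J : Type} (j : Fin m → J) : DecidableLE (NCBelow j) := Classical.decRel _

/-- The total coefficient of `σ` in the moment-cumulant formula for colours `j`: the sum of the
Möbius function `μ(σ, π)` of the lattice of all non-crossing partitions over `π ≤ ker j`. -/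
def ncCoeff {m : ℕ} {J : Type} (j : Fin m → J) (σ : NCBelow j) : ℂ :=
  ∑ π : NCBelow j with σ ≤ π, ((IncidenceAlgebra.mu ℤ σ.1 π.1 : ℤ) : ℂ)

theorem sum_upper_ncCoeff {m : ℕ} {J : Type} (j : Fin m → J) (ρ : NCBelow j) :
    ∑ σ with ρ ≤ σ, ncCoeff j σ = 1 := by
  classical
  simp only [ncCoeff, Finset.sum_filter]
  rw [Finset.sum_congr rfl (g := fun σ : NCBelow j => ∑ π : NCBelow j,
    if ρ ≤ σ ∧ σ ≤ π then ((IncidenceAlgebra.mu ℤ σ.1 π.1 : ℤ) : ℂ) else 0)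
    (fun σ _ => by by_cases h : ρ ≤ σ <;> simp [h]), Finset.sum_comm]
  have inner : ∀ π : NCBelow j, (∑ σ : NCBelow j,
      if ρ ≤ σ ∧ σ ≤ π then ((IncidenceAlgebra.mu ℤ σ.1 π.1 : ℤ) : ℂ) else 0)
        = if ρ = π then 1 else 0 := by
    intro π
    have h := IncidenceAlgebra.sum_Icc_mu_left (𝕜 := ℤ) ρ.1 π.1
    rw [← Finset.sum_filter, ← Int.cast_sum]
    rw [show (if ρ = π then (1 : ℂ) else 0) = ((if ρ.1 = π.1 then 1 else 0 : ℤ) : ℂ) by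
      simp [Subtype.ext_iff], ← h]
    congr 1
    refine Finset.sum_bij (fun σ _ => σ.1) ?_ ?_ ?_ ?_
    · intro σ hσ
      simpa using hσ
    · intro a _ b _ hab
      exact Subtype.ext hab
    · intro σ hσ
      rw [Finset.mem_Icc] at hσ
      refine ⟨⟨σ, le_trans (show σ.1 ≤ π.1.1 from hσ.2) π.2⟩,
        Finset.mem_filter.2 ⟨Finset.mem_univ _, hσ⟩, rfl⟩
    · intro σ _
      rfl
  simp [inner]

/-! ### Pullbacks of non-crossing partitions and their left adjoints -/

/-- The pullback of a non-crossing partition along a monotone map. -/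
def ncComap {m m' : ℕ} (g : Fin m →o Fin m') (ρ : NC m') : NC m :=
  ⟨partOfSetoid (Setoid.comap g (Part.setoid ρ.1)), by
    rw [isNonCrossing_iff, setoid_partOfSetoid]
    intro s₁ t₁ s₂ t₂ h1 h2 h3 hs ht
    simp only [Setoid.comap_rel] at hs ht ⊢
    rcases (g.monotone h1.le).eq_or_lt with e1 | h1
    · rw [e1]
    rcases (g.monotone h2.le).eq_or_lt with e2 | h2
    · rwa [e2]
    rcases (g.monotone h3.le).eq_or_lt with e3 | h3
    · rw [← e3] at ht
      exact (Part.setoid ρ.1).trans hs ((Part.setoid ρ.1).symm ht)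
    exact isNonCrossing_iff.1 ρ.2 _ _ _ _ h1 h2 h3 hs ht⟩

theorem setoid_ncComap {m m' : ℕ} (g : Fin m →o Fin m') (ρ : NC m') (a b : Fin m) :
    Part.setoid (ncComap g ρ).1 a b ↔ Part.setoid ρ.1 (g a) (g b) := by
  rw [ncComap, setoid_partOfSetoid, Setoid.comap_rel]

/-- The pullback of partitions along a monotone map, on the posets `NCBelow`. -/
def ncBelowComap {m m' : ℕ} {J : Type} (j : Fin m' → J) (g : Fin m →o Fin m') (ρ : NCBelow j) :
    NCBelow (j ∘ g) :=
  ⟨ncComap g ρ.1, le_kerPart_iff.2 fun _ _ h =>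
    le_kerPart_iff.1 ρ.2 _ _ ((setoid_ncComap g ρ.1 _ _).1 h)⟩

theorem setoid_ncBelowComap {m m' : ℕ} {J : Type} {j : Fin m' → J} {g : Fin m →o Fin m'}
    {ρ : NCBelow j} {a b : Fin m} :
    Part.setoid (ncBelowComap j g ρ).1.1 a b ↔ Part.setoid ρ.1.1 (g a) (g b) :=
  setoid_ncComap g ρ.1 a b

theorem ncBelow_le_iff {m : ℕ} {J : Type} {j : Fin m → J} {σ π : NCBelow j} :
    σ ≤ π ↔ ∀ a b, Part.setoid σ.1.1 a b → Part.setoid π.1.1 a b :=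
  part_le_iff

/-- Inserting the singleton block `{r}` is left adjoint to removing the point `r`. -/
theorem exists_gc_succAbove {m : ℕ} {J : Type} (j : Fin (m + 1) → J) (r : Fin (m + 1)) :
    ∃ l, GaloisConnection l (ncBelowComap j (Fin.succAboveOrderEmb r).toOrderHom) := by
  have hs : ∀ ρ : NCBelow (j ∘ (Fin.succAboveOrderEmb r).toOrderHom), ∃ s : Setoid (Fin (m + 1)),
      ∀ x y, s x y ↔ x = y ∨ ∃ a b, r.succAbove a = x ∧ r.succAbove b = y ∧
        Part.setoid ρ.1.1 a b := by
    intro ρ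
    refine ⟨⟨fun x y => x = y ∨ ∃ a b, r.succAbove a = x ∧ r.succAbove b = y ∧
      Part.setoid ρ.1.1 a b, fun x => Or.inl rfl, ?_, ?_⟩, fun x y => Iff.rfl⟩
    · rintro x y (rfl | ⟨a, b, ha, hb, h⟩)
      · exact Or.inl rfl
      · exact Or.inr ⟨b, a, hb, ha, (Part.setoid ρ.1.1).symm h⟩
    · rintro x y z (rfl | ⟨a, b, ha, rfl, h⟩) h'
      · exact h'
      · rcases h' with rfl | ⟨c, d, hc, hd, h'⟩
        · exact Or.inr ⟨a, b, ha, rfl, h⟩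
        · rw [Fin.succAbove_right_inj] at hc
          subst hc
          exact Or.inr ⟨a, d, ha, hd, (Part.setoid ρ.1.1).trans h h'⟩
  choose s hs using hs
  refine ⟨fun ρ => ⟨⟨partOfSetoid (s ρ), ?_⟩, ?_⟩, fun ρ σ => ?_⟩
  · rw [isNonCrossing_iff, setoid_partOfSetoid]
    intro s₁ t₁ s₂ t₂ h1 h2 h3 hs' ht
    rw [hs] at hs' ht ⊢
    rcases hs' with rfl | ⟨a, b, rfl, rfl, h⟩
    · exact absurd (h1.trans h2) (lt_irrefl _)
    rcases ht with rfl | ⟨c, d, rfl, rfl, h'⟩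
    · exact absurd (h2.trans h3) (lt_irrefl _)
    rw [Fin.succAbove_lt_succAbove_iff] at h1 h2 h3
    exact Or.inr ⟨a, c, rfl, rfl, isNonCrossing_iff.1 ρ.1.2 _ _ _ _ h1 h2 h3 h h'⟩
  · rw [le_kerPart_iff, setoid_partOfSetoid]
    intro x y h
    rcases (hs _ _ _).1 h with rfl | ⟨a, b, rfl, rfl, hab⟩
    · rfl
    · exact le_kerPart_iff.1 ρ.2 _ _ hab
  · rw [ncBelow_le_iff, ncBelow_le_iff, setoid_partOfSetoid]
    constructor
    · intro h a b hab
      exact setoid_ncBelowComap.2 (h _ _ ((hs _ _ _).2 (Or.inr ⟨a, b, rfl, rfl, hab⟩)))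
    · intro h x y hxy
      rcases (hs _ _ _).1 hxy with rfl | ⟨a, b, rfl, rfl, hab⟩
      · exact (Part.setoid σ.1.1).iseqv.refl _
      · exact setoid_ncBelowComap.1 (h _ _ hab)

/-- Uniting the blocks of two adjacent points `a` and `b = a + 1` keeps a partition non-crossing.
The relation `R x y ∨ (R x a ∧ R b y) ∨ (R x b ∧ R a y)` is the one with the two blocks united. -/
theorem join_noncrossing {M : ℕ} {R : Setoid (Fin M)} {a b : Fin M} (hab : (a : ℕ) + 1 = b)
    (nc : ∀ s₁ t₁ s₂ t₂ : Fin M, s₁ < t₁ → t₁ < s₂ → s₂ < t₂ → R s₁ s₂ → R t₁ t₂ → R s₁ t₁)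
    {s₁ t₁ s₂ t₂ : Fin M} (l1 : s₁ < t₁) (l2 : t₁ < s₂) (l3 : s₂ < t₂)
    (hs : R s₁ s₂ ∨ (R s₁ a ∧ R b s₂) ∨ (R s₁ b ∧ R a s₂))
    (ht : R t₁ t₂ ∨ (R t₁ a ∧ R b t₂) ∨ (R t₁ b ∧ R a t₂)) :
    R s₁ t₁ ∨ (R s₁ a ∧ R b t₁) ∨ (R s₁ b ∧ R a t₁) := by
  have rr : ∀ x, R x x := R.iseqv.refl
  have rs : ∀ x y, R x y → R y x := fun x y => R.iseqv.symm
  have rt : ∀ x y z, R x y → R y z → R x z := fun x y z => R.iseqv.trans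
  -- The coercion of a `Setoid` to a relation is replaced by a variable, for the sake of `grind`.
  generalize hR : (fun x y => R x y) = S
  have hS : ∀ x y, R x y ↔ S x y := by simp [← hR]
  simp only [hS] at *
  clear hS hR
  rcases hs with hs | ⟨hs, hs'⟩ | ⟨hs, hs'⟩ <;> rcases ht with ht | ⟨ht, ht'⟩ | ⟨ht, ht'⟩
  · exact Or.inl (nc _ _ _ _ l1 l2 l3 hs ht)
  -- `s₁` lies in the block of `b`, `s₂` in that of `a`, and `t₁, t₂` in one block of `R`: the
  -- instance of `nc` to be used depends on the position of `a` and `b` relative to `t₁` and `t₂`.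
  pick_goal 6
  · rcases lt_trichotomy b t₁ with h | h | h
    · have := nc a t₁ s₂ t₂ (by omega) l2 l3 hs' ht
      grind
    · grind
    · rcases lt_trichotomy b t₂ with h' | h' | h'
      · have := nc s₁ t₁ b t₂ l1 h h' hs ht
        grind
      · grind
      · by_cases e : a = t₂
        · grind
        · have := nc t₁ s₂ t₂ a l2 l3 (by omega) ht (rs _ _ hs')
          grind
  all_goals grind

/-- Joining the blocks of `r` and `r + 1` and then identifying these two points is left adjoint to
doubling the point `r`. -/
theorem exists_gc_predAbove {m : ℕ} {J : Type} (j : Fin (m + 1) → J) (r : Fin (m + 1)) :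
    ∃ l, GaloisConnection l (ncBelowComap j ⟨r.predAbove, r.predAbove_right_monotone⟩) := by
  have hd : r.predAbove r.castSucc = r.predAbove r.succ := by simp
  have hs : ∀ ρ : NCBelow (j ∘ r.predAbove), ∃ s : Setoid (Fin (m + 2)),
      ∀ x y, s x y ↔ Part.setoid ρ.1.1 x y ∨
        (Part.setoid ρ.1.1 x r.castSucc ∧ Part.setoid ρ.1.1 r.succ y) ∨
        (Part.setoid ρ.1.1 x r.succ ∧ Part.setoid ρ.1.1 r.castSucc y) := by
    intro ρ
    have h1 := (Part.setoid ρ.1.1).iseqv.refl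
    have h2 := @(Part.setoid ρ.1.1).iseqv.symm
    have h3 := @(Part.setoid ρ.1.1).iseqv.trans
    refine ⟨⟨fun x y => _, ?_, ?_, ?_⟩, fun x y => Iff.rfl⟩
    · exact fun x => Or.inl (h1 x)
    · rintro x y (h | ⟨h, h'⟩ | ⟨h, h'⟩)
      · exact Or.inl (h2 h)
      · exact Or.inr (Or.inr ⟨h2 h', h2 h⟩)
      · exact Or.inr (Or.inl ⟨h2 h', h2 h⟩)
    · rintro x y z (h | ⟨h, h'⟩ | ⟨h, h'⟩) (k | ⟨k, k'⟩ | ⟨k, k'⟩)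
      · exact Or.inl (h3 h k)
      · exact Or.inr (Or.inl ⟨h3 h k, k'⟩)
      · exact Or.inr (Or.inr ⟨h3 h k, k'⟩)
      · exact Or.inr (Or.inl ⟨h, h3 h' k⟩)
      · exact Or.inr (Or.inl ⟨h, k'⟩)
      · exact Or.inl (h3 h k')
      · exact Or.inr (Or.inr ⟨h, h3 h' k⟩)
      · exact Or.inl (h3 h k')
      · exact Or.inr (Or.inr ⟨h, k'⟩)
  choose s hs using hs
  have hnc : ∀ ρ, IsNonCrossing (partOfSetoid (s ρ)) := by
    intro ρ
    rw [isNonCrossing_iff, setoid_partOfSetoid]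
    intro s₁ t₁ s₂ t₂ l1 l2 l3 hs' ht
    rw [hs] at hs' ht ⊢
    exact join_noncrossing (by simp) (isNonCrossing_iff.1 ρ.1.2) l1 l2 l3 hs' ht
  -- The join with the pair `{r, r + 1}` is pulled back along a section of `r.predAbove`.
  let N : NCBelow (j ∘ r.predAbove) → NC (m + 2) := fun ρ => ⟨partOfSetoid (s ρ), hnc ρ⟩
  have hN : ∀ ρ x y, Part.setoid (N ρ).1 x y ↔ s ρ x y := fun ρ x y => by
    rw [show (N ρ).1 = partOfSetoid (s ρ) from rfl, setoid_partOfSetoid]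
  have sec : ∀ ρ x, s ρ (r.castSucc.succAbove (r.predAbove x)) x := by
    intro ρ x
    by_cases hx : x = r.castSucc
    · subst hx
      rw [hs]
      right; right
      rw [Fin.predAbove_castSucc_self, Fin.succAbove_castSucc_self]
      exact ⟨(Part.setoid ρ.1.1).iseqv.refl _, (Part.setoid ρ.1.1).iseqv.refl _⟩
    · rw [Fin.succAbove_predAbove hx]
  have ret : ∀ x, r.predAbove (r.castSucc.succAbove x) = x := fun x =>
    Fin.predAbove_succAbove r x
  refine ⟨fun ρ => ⟨ncComap (Fin.succAboveOrderEmb r.castSucc).toOrderHom (N ρ), ?_⟩,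
    fun ρ σ => ?_⟩
  · rw [le_kerPart_iff]
    intro x y h
    have h := (hN _ _ _).1 ((setoid_ncComap _ _ _ _).1 h)
    have key : ∀ x y, s ρ x y → j (r.predAbove x) = j (r.predAbove y) := by
      intro x y h
      have hk : ∀ a b, Part.setoid ρ.1.1 a b → j (r.predAbove a) = j (r.predAbove b) :=
        le_kerPart_iff.1 ρ.2
      rcases (hs _ _ _).1 h with h | ⟨h, h'⟩ | ⟨h, h'⟩
      · exact hk _ _ h
      · rw [hk _ _ h, hd, hk _ _ h']
      · rw [hk _ _ h, ← hd, hk _ _ h']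
    have := key _ _ h
    rwa [← ret x, ← ret y]
  · rw [ncBelow_le_iff, ncBelow_le_iff]
    constructor
    · intro h a b hab
      refine setoid_ncBelowComap.2 (h _ _ ((setoid_ncComap _ _ _ _).2 ((hN _ _ _).2 ?_)))
      exact (s ρ).iseqv.trans (sec ρ a) ((s ρ).iseqv.trans ((hs _ _ _).2 (Or.inl hab))
        ((s ρ).iseqv.symm (sec ρ b)))
    · intro h x y hxy
      have h' : ∀ a b, Part.setoid ρ.1.1 a b →
          Part.setoid σ.1.1 (r.predAbove a) (r.predAbove b) :=
        fun a b hab => setoid_ncBelowComap.1 (h a b hab)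
      have key : ∀ x y, s ρ x y → Part.setoid σ.1.1 (r.predAbove x) (r.predAbove y) := by
        intro x y hxy
        rcases (hs _ _ _).1 hxy with k | ⟨k, k'⟩ | ⟨k, k'⟩
        · exact h' _ _ k
        · exact (Part.setoid σ.1.1).iseqv.trans (h' _ _ k) (hd ▸ h' _ _ k')
        · exact (Part.setoid σ.1.1).iseqv.trans (h' _ _ k) (hd ▸ h' _ _ k')
      have := key _ _ ((hN _ _ _).1 ((setoid_ncComap _ _ _ _).1 hxy))
      rwa [← ret x, ← ret y]

/-! ### Joint moments of free families -/

section BlockProd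

variable {R : Type} [CommMonoid R]

/-- The multiplicative extension of `τ` to partitions: the product over the blocks `V` of `σ` of `τ`
at the product of the arguments with index in `V`. The arguments commute, so no order is needed. -/
def blockProd {m : ℕ} (τ : R → ℂ) (a : Fin m → R) (σ : Part m) : ℂ :=
  ∏ V ∈ σ.parts, τ (∏ r ∈ V, a r)

theorem mem_parts_ncComap {m m' : ℕ} (g : Fin m →o Fin m') (ρ : NC m') (V : Finset (Fin m)) :
    V ∈ (ncComap g ρ).1.parts ↔
      V.Nonempty ∧ ∃ W ∈ ρ.1.parts, (Finset.univ.filter fun r => g r ∈ W) = V := by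
  set σ := (ncComap g ρ).1 with hσ
  have hpart : ∀ a, σ.part a = Finset.univ.filter fun r => g r ∈ ρ.1.part (g a) := by
    intro a
    ext b
    exact (setoid_ncComap g ρ a b).trans (by simp; rfl)
  constructor
  · intro hV
    obtain ⟨a, ha⟩ := σ.nonempty_of_mem_parts hV
    exact ⟨⟨a, ha⟩, ρ.1.part (g a), ρ.1.part_mem.2 (Finset.mem_univ _), by
      rw [← hpart, σ.part_eq_of_mem hV ha]⟩
  · rintro ⟨⟨a, ha⟩, W, hW, rfl⟩
    rw [← ρ.1.part_eq_of_mem hW (Finset.mem_filter.1 ha).2, ← hpart]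
    exact σ.part_mem.2 (Finset.mem_univ _)

/-- Pulling back a partition along `g` amounts to multiplying the arguments in the fibres of `g`.
Blocks outside the range of `g` contribute the factor `τ 1 = 1`. -/
theorem blockProd_ncComap {m m' : ℕ} {τ : R → ℂ} (hτ : τ 1 = 1) (g : Fin m →o Fin m')
    (a : Fin m → R) (ρ : NC m') :
    blockProd τ a (ncComap g ρ).1 = blockProd τ (fun q => ∏ r with g r = q, a r) ρ.1 := by
  classical
  have hfib : ∀ W : Finset (Fin m'), ∏ q ∈ W, ∏ r with g r = q, a r =
      ∏ r with g r ∈ W, a r := by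
    intro W
    rw [Finset.prod_filter (fun r => g r ∈ W)]
    simp only [Finset.prod_filter]
    rw [Finset.prod_comm]
    exact Finset.prod_congr rfl fun r _ => by rw [Finset.prod_ite_eq]
  have hparts : (ncComap g ρ).1.parts =
      (ρ.1.parts.image fun W => Finset.univ.filter fun r => g r ∈ W).erase ∅ := by
    ext V
    rw [mem_parts_ncComap, Finset.mem_erase, Finset.mem_image, Finset.nonempty_iff_ne_empty]
  unfold blockProd
  rw [hparts, Finset.prod_erase _ (by simpa using hτ), Finset.prod_image_of_pairwise_eq_one]
  · exact Finset.prod_congr rfl fun W _ => by rw [hfib]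
  · intro W hW W' hW' hne heq
    rw [show (Finset.univ.filter fun r => g r ∈ W) = ∅ from ?_]
    · simpa using hτ
    · refine Finset.eq_empty_of_forall_notMem fun r hr => hne ?_
      have hr' := hr
      rw [heq] at hr'
      exact ρ.1.eq_of_mem_parts hW hW' (Finset.mem_filter.1 hr).2 (Finset.mem_filter.1 hr').2

/-- The joint moment that free copies of `(R, τ)` assign to the word with letters `a r` in the copy
of colour `j r`: the sum over the non-crossing `π ≤ ker j` of the free cumulants
`∑_{σ ≤ π} μ(σ, π) τ_σ(a)`, collected into one sum over `σ`. -/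
def ncMoment {m : ℕ} {J : Type} (τ : R → ℂ) (j : Fin m → J) (a : Fin m → R) : ℂ :=
  ∑ σ : NCBelow j, ncCoeff j σ * blockProd τ a σ.1.1

theorem ncMoment_comp {m m' : ℕ} {J : Type} {τ : R → ℂ} (hτ : τ 1 = 1) (j : Fin m' → J)
    (g : Fin m →o Fin m') (hg : ∃ l, GaloisConnection l (ncBelowComap j g)) (a : Fin m → R) :
    ncMoment τ (j ∘ g) a = ncMoment τ j (fun q => ∏ r with g r = q, a r) := by
  obtain ⟨l, gc⟩ := hg
  unfold ncMoment
  rw [← sum_comp_upperAdjoint gc (sum_upper_ncCoeff _) (sum_upper_ncCoeff _)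
    (fun σ => blockProd τ a σ.1.1)]
  exact Finset.sum_congr rfl fun ρ _ => by rw [← blockProd_ncComap hτ]; rfl

/-- A unit among the arguments may be removed. -/
theorem ncMoment_removeOne {m : ℕ} {J : Type} {τ : R → ℂ} (hτ : τ 1 = 1) (j : Fin (m + 1) → J)
    (a : Fin (m + 1) → R) (r : Fin (m + 1)) (hr : a r = 1) :
    ncMoment τ j a = ncMoment τ (j ∘ r.succAbove) (a ∘ r.succAbove) := by
  refine Eq.trans ?_ (ncMoment_comp hτ j (Fin.succAboveOrderEmb r).toOrderHom
    (exists_gc_succAbove j r) (a ∘ r.succAbove)).symm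
  congr 1
  funext q
  rcases Fin.eq_self_or_eq_succAbove r q with rfl | ⟨q, rfl⟩
  · rw [hr, Finset.filter_false_of_mem, Finset.prod_empty]
    intro b _
    exact Fin.succAbove_ne _ b
  · rw [Finset.prod_filter]
    simp

/-- Adjacent arguments of the same colour may be multiplied. -/
theorem ncMoment_merge {m : ℕ} {J : Type} {τ : R → ℂ} (hτ : τ 1 = 1) (j : Fin (m + 2) → J)
    (a : Fin (m + 2) → R) (r : Fin (m + 1)) (hr : j r.castSucc = j r.succ) :
    ncMoment τ j a = ncMoment τ (j ∘ r.castSucc.succAbove)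
      (fun q => ∏ b with r.predAbove b = q, a b) := by
  refine Eq.trans ?_ (ncMoment_comp hτ (j ∘ r.castSucc.succAbove)
    ⟨r.predAbove, r.predAbove_right_monotone⟩ (exists_gc_predAbove _ r) a)
  have : j = (j ∘ r.castSucc.succAbove) ∘ r.predAbove := by
    funext x
    by_cases hx : x = r.castSucc
    · subst hx
      simp [hr]
    · simp [Fin.succAbove_predAbove hx]
  exact congrArg (fun j => ncMoment τ j a) this

theorem prod_predAbove_fiber {m : ℕ} (a : Fin (m + 2) → R) (r q : Fin (m + 1)) :
    ∏ b with r.predAbove b = q, a b =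
      if q < r then a q.castSucc else if q = r then a r.castSucc * a r.succ else a q.succ := by
  have hmem : ∀ b : Fin (m + 2), r.predAbove b = q ↔
      (if q < r then (b : ℕ) = q else if q = r then (b : ℕ) = r ∨ (b : ℕ) = r + 1
        else (b : ℕ) = q + 1) := by
    intro b
    unfold Fin.predAbove
    split_ifs <;> simp only [Fin.ext_iff, Fin.lt_def, Fin.val_pred, Fin.coe_castPred]
      at * <;> have hc : (r.castSucc : ℕ) = r := rfl <;> omega
  simp only [hmem]
  split_ifs with h1 h2
  · exact (Finset.prod_congr (by ext b; simp [Fin.ext_iff]) fun _ _ => rfl).trans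
      (Finset.prod_singleton a q.castSucc)
  · exact (Finset.prod_congr (by ext b; simp [Fin.ext_iff]) fun _ _ => rfl).trans
      (Finset.prod_pair (Fin.castSucc_lt_succ (i := r)).ne)
  · exact (Finset.prod_congr (by ext b; simp [Fin.ext_iff]) fun _ _ => rfl).trans
      (Finset.prod_singleton a q.succ)

/-- A non-crossing partition has a block that is an interval, and such a block is a singleton if `j`
is constant on blocks and adjacent values of `j` differ. -/
theorem exists_singleton_mem_parts {m : ℕ} {J : Type} {j : Fin (m + 1) → J}
    (hj : ∀ r : Fin m, j r.castSucc ≠ j r.succ) (σ : NCBelow j) :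
    ∃ r, {r} ∈ σ.1.1.parts := by
  by_contra! hno
  set S := Part.setoid σ.1.1 with hS
  have hex : ∀ r, ∃ s, s ≠ r ∧ S r s := by
    intro r
    by_contra! hr
    refine hno r ?_
    convert σ.1.1.part_mem.2 (Finset.mem_univ r)
    ext s
    rw [Finset.mem_singleton]
    exact ⟨fun h => by subst h; exact σ.1.1.mem_part (Finset.mem_univ s), fun h => by
      by_contra hs
      exact hr s hs h⟩
  have hd : ∃ d : ℕ, ∃ a b : Fin (m + 1), (a : ℕ) + d = b ∧ a < b ∧ S a b := by
    obtain ⟨s, hs, h⟩ := hex 0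
    exact ⟨s, 0, s, by simp, Fin.pos_of_ne_zero hs, h⟩
  -- Take two points `a < b` of one block at minimal distance. If they are not adjacent, the partner
  -- `d` of `c = a + 1` is either too close to `c` or forces a crossing.
  classical
  obtain ⟨a, b, hab, hlt, hr⟩ := Nat.find_spec hd
  have hmin : ∀ x y : Fin (m + 1), x < y → S x y → (b : ℕ) - a ≤ y - x := by
    intro x y hxy h
    have := Nat.find_min' hd ⟨x, y, (by omega : (x : ℕ) + (y - x) = y), hxy, h⟩
    omega
  by_cases hadj : (b : ℕ) = a + 1
  · have := hj ⟨a, by omega⟩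
    refine this (Eq.trans ?_ ((le_kerPart_iff.1 σ.2 _ _ hr).trans ?_))
    · rfl
    · congr 1
      exact Fin.ext hadj
  · obtain ⟨c, hc⟩ : ∃ c : Fin (m + 1), (c : ℕ) = a + 1 := ⟨⟨a + 1, by omega⟩, rfl⟩
    have nc := isNonCrossing_iff.1 σ.1.2
    obtain ⟨d, hdc, hcd⟩ := hex c
    have hac : ¬ S a c := fun h => by
      have := hmin a c (by omega) h
      omega
    have hda : d ≠ a := fun h => hac (S.iseqv.symm (h ▸ hcd))
    have hdb : d ≠ b := fun h => hac (S.iseqv.trans hr (S.iseqv.symm (h ▸ hcd)))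
    rcases lt_or_gt_of_ne hda with h | h
    · exact hac (S.iseqv.symm (S.iseqv.trans hcd
        (nc d a c b h (by omega) (by omega) (S.iseqv.symm hcd) hr)))
    · rcases lt_or_gt_of_ne hdb with h' | h'
      · have := hmin c d (by omega) hcd
        omega
      · exact hac (nc a c b d (by omega) (by omega) h' hr hcd)

/-- Moments of centered words with alternating colours vanish. -/
theorem ncMoment_eq_zero {m : ℕ} {J : Type} {τ : R → ℂ} {j : Fin (m + 1) → J}
    (hj : ∀ r : Fin m, j r.castSucc ≠ j r.succ) {a : Fin (m + 1) → R} (ha : ∀ r, τ (a r) = 0) :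
    ncMoment τ j a = 0 := by
  refine Finset.sum_eq_zero fun σ _ => ?_
  obtain ⟨r, hr⟩ := exists_singleton_mem_parts hj σ
  rw [blockProd, Finset.prod_eq_zero hr (by simpa using ha r), mul_zero]

end BlockProd

/-! ### Noncommutative products with a removed or a merged factor -/

section ListProd

variable {M : Type} [Monoid M]

theorem prod_ofFn_removeOne {m : ℕ} (f : Fin (m + 1) → M) (r : Fin (m + 1)) (hr : f r = 1) :
    (List.ofFn f).prod = (List.ofFn (f ∘ r.succAbove)).prod := by
  induction m with
  | zero =>
    obtain rfl : r = 0 := by omega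
    simp [hr]
  | succ m ih =>
    rw [List.ofFn_succ, List.prod_cons]
    cases r using Fin.cases with
    | zero => rw [hr, one_mul]; rfl
    | succ r =>
      rw [ih (fun i => f i.succ) r hr]
      conv_rhs => rw [List.ofFn_succ, List.prod_cons]
      simp [Function.comp_def]

theorem prod_ofFn_merge {m : ℕ} (f : Fin (m + 2) → M) (r : Fin (m + 1)) :
    (List.ofFn f).prod = (List.ofFn fun q : Fin (m + 1) =>
      if q < r then f q.castSucc else if q = r then f r.castSucc * f r.succ
        else f q.succ).prod := by
  induction m with
  | zero =>
    obtain rfl : r = 0 := by omega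
    simp
  | succ m ih =>
    cases r using Fin.cases with
    | zero =>
      simp [List.ofFn_succ, mul_assoc]
    | succ r =>
      rw [List.ofFn_succ, List.prod_cons, ih (fun i => f i.succ) r]
      conv_rhs => rw [List.ofFn_succ, List.prod_cons]
      simp

end ListProd

/-! ### Words in a free product of groups -/

section FreeProduct

variable {J C : Type} [CommGroup C]

/-- The copy of `C` of colour `j` in the free product of copies of `C`. -/
abbrev letter (j : J) : C →* Monoid.CoprodI (fun _ : J => C) :=
  Monoid.CoprodI.of (M := fun _ : J => C) (i := j)

/-- A nonempty reduced word in a free product is not `1`. -/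
theorem prod_letter_ne_one {m : ℕ} {j : Fin (m + 1) → J} {t : Fin (m + 1) → C}
    (hj : ∀ r : Fin m, j r.castSucc ≠ j r.succ) (ht : ∀ r, t r ≠ 1) :
    (List.ofFn fun r => letter (j r) (t r)).prod ≠ 1 := by
  classical
  let w : Monoid.CoprodI.Word (fun _ : J => C) :=
    { toList := List.ofFn fun r => ⟨j r, t r⟩
      ne_one := by
        intro l hl
        obtain ⟨r, rfl⟩ := (List.mem_ofFn' _ _).1 hl
        exact ht r
      chain_ne := by
        rw [List.isChain_iff_getElem]
        intro i hi
        simp only [List.length_ofFn, List.getElem_ofFn] at hi ⊢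
        exact hj ⟨i, by omega⟩ }
  intro h
  have hw : w.prod = 1 := by
    rw [← h, Monoid.CoprodI.Word.prod, List.map_ofFn]
    rfl
  have : w = Monoid.CoprodI.Word.empty := by
    apply (Monoid.CoprodI.Word.equiv (M := fun _ : J => C)).symm.injective
    exact hw.trans Monoid.CoprodI.Word.prod_empty.symm
  have := congrArg (fun w => w.toList.length) this
  simp [w, Monoid.CoprodI.Word.empty] at this

theorem ncMoment_fin_zero {R : Type} [CommMonoid R] (τ : R → ℂ) (j : Fin 0 → J) (a : Fin 0 → R) :
    ncMoment τ j a = 1 := by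
  let ρ : NCBelow j := ⟨⟨⊥, isNonCrossing_iff.2 fun s => s.elim0⟩, bot_le⟩
  rw [← sum_upper_ncCoeff j ρ,
    Finset.filter_true_of_mem fun σ _ => ncBelow_le_iff.2 fun a => a.elim0]
  refine Finset.sum_congr rfl fun σ _ => ?_
  have : σ.1.1.parts = ∅ := by
    refine Finset.eq_empty_of_forall_notMem fun V hV => ?_
    obtain ⟨a, -⟩ := σ.1.1.nonempty_of_mem_parts hV
    exact a.elim0
  rw [blockProd, this, Finset.prod_empty, mul_one]

/-- The moment-cumulant formula for group elements: whether a word is `1` in the free product is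
decided by deleting units and multiplying adjacent letters of the same colour, and `ncMoment` obeys
the same rules. -/
theorem ncMoment_group [DecidableEq C] [DecidableEq (Monoid.CoprodI (fun _ : J => C))] {m : ℕ}
    (j : Fin m → J) (t : Fin m → C) :
    (if (List.ofFn fun r => letter (j r) (t r)).prod = 1
      then (1 : ℂ) else 0) = ncMoment (fun t : C => if t = 1 then 1 else 0) j t := by
  induction m with
  | zero => rw [ncMoment_fin_zero]; simp
  | succ m ih =>
    by_cases h1 : ∃ r, t r = 1
    · obtain ⟨r, hr⟩ := h1
      rw [ncMoment_removeOne (by simp) j t r hr, ← ih,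
        prod_ofFn_removeOne _ r (by rw [hr, map_one])]
      rfl
    by_cases h2 : ∀ r : Fin m, j r.castSucc ≠ j r.succ
    · push Not at h1
      rw [if_neg (prod_letter_ne_one h2 h1), ncMoment_eq_zero h2 fun r => if_neg (h1 r)]
    · push Not at h2
      obtain ⟨r, hr⟩ := h2
      obtain _ | m := m
      · exact r.elim0
      rw [ncMoment_merge (by simp) j t r hr, ← ih, prod_ofFn_merge _ r]
      have : ∀ q, (if q < r then letter (j q.castSucc) (t q.castSucc)
          else if q = r then letter (j r.castSucc) (t r.castSucc) *
            letter (j r.succ) (t r.succ)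
          else letter (j q.succ) (t q.succ)) =
          letter ((j ∘ r.castSucc.succAbove) q)
            (∏ b with r.predAbove b = q, t b) := by
        intro q
        rw [prod_predAbove_fiber]
        simp only [Function.comp]
        split_ifs with c1 c2
        · rw [Fin.succAbove_of_castSucc_lt _ _ (by simpa using c1)]
        · subst c2
          rw [Fin.succAbove_castSucc_self, map_mul, hr]
        · rw [Fin.succAbove_of_le_castSucc _ _ (by simpa using c1)]
      simp only [this]

end FreeProduct

/-! ### Moments in the group algebra -/

section Linear

variable {R : Type} [CommRing R] [Algebra ℂ R]

/-- Only the factor of the block of `r` depends on the argument with index `r`, and linearly so. -/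
theorem blockProd_update {m : ℕ} (τ : R →ₗ[ℂ] ℂ) (a : Fin m → R) (σ : Part m) (r : Fin m)
    (x : R) :
    blockProd τ (Function.update a r x) σ =
      τ (x * ∏ s ∈ σ.part r \ {r}, a s) * ∏ V ∈ σ.parts.erase (σ.part r), τ (∏ s ∈ V, a s) := by
  rw [blockProd, ← Finset.mul_prod_erase _ _ (σ.part_mem.2 (Finset.mem_univ r)),
    Finset.prod_update_of_mem (σ.mem_part (Finset.mem_univ r))]
  congr 1
  refine Finset.prod_congr rfl fun V hV => ?_
  rw [Finset.mem_erase] at hV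
  rw [Finset.prod_update_of_notMem]
  intro hr
  exact hV.1 (σ.part_eq_of_mem hV.2 hr).symm

/-- `ncMoment` for a linear functional, as a multilinear map. -/
def ncMomentMultilinear {m : ℕ} {J : Type} (τ : R →ₗ[ℂ] ℂ) (j : Fin m → J) :
    MultilinearMap ℂ (fun _ : Fin m => R) ℂ where
  toFun a := ncMoment τ j a
  map_update_add' := by
    intro inst a r x y
    obtain rfl : inst = instDecidableEqFin m := Subsingleton.elim _ _
    simp only [ncMoment, blockProd_update, add_mul, map_add, mul_add, Finset.sum_add_distrib]
  map_update_smul' := by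
    intro inst a r c x
    obtain rfl : inst = instDecidableEqFin m := Subsingleton.elim _ _
    simp only [ncMoment, blockProd_update, smul_mul_assoc, map_smul, Finset.smul_sum,
      mul_smul_comm]

end Linear

section Moments

variable {J C A : Type} [CommGroup C] [Ring A] [Algebra ℂ A]

/-- The coefficient of the unit, the canonical trace on the group algebra. -/
def groupTrace (C : Type) [CommGroup C] : MonoidAlgebra ℂ C →ₗ[ℂ] ℂ where
  toFun a := a.coeff 1
  map_add' _ _ := rfl
  map_smul' _ _ := rfl

theorem groupTrace_single [DecidableEq C] (g : C) (c : ℂ) :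
    groupTrace C (MonoidAlgebra.single g c) = if g = 1 then c else 0 := by
  change (MonoidAlgebra.single g c).coeff 1 = _
  rw [MonoidAlgebra.coeff_single, Finsupp.single_apply]

/-- The copy of colour `j` of the group algebra of `C` that a representation `U` of the free product
induces. -/
def colourHom (U : Monoid.CoprodI (fun _ : J => C) →* A) (j : J) : MonoidAlgebra ℂ C →ₐ[ℂ] A :=
  MonoidAlgebra.lift ℂ A C (U.comp (letter j))

theorem colourHom_of (U : Monoid.CoprodI (fun _ : J => C) →* A) (j : J) (s : C) :
    colourHom U j (MonoidAlgebra.of ℂ C s) = U (letter j s) := by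
  simp [colourHom]

theorem apply_colourHom [DecidableEq (Monoid.CoprodI (fun _ : J => C))]
    {U : Monoid.CoprodI (fun _ : J => C) →* A} {φ : A →ₗ[ℂ] ℂ}
    (hφ : ∀ g, φ (U g) = if g = 1 then 1 else 0) (j : J) (x : MonoidAlgebra ℂ C) :
    φ (colourHom U j x) = groupTrace C x := by
  classical
  have : φ ∘ₗ (colourHom U j).toLinearMap = groupTrace C := by
    refine (MonoidAlgebra.basis C ℂ).ext fun s => ?_
    change φ (colourHom U j (MonoidAlgebra.of ℂ C s)) = _
    rw [colourHom_of, hφ, MonoidAlgebra.basis_apply, groupTrace_single]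
    exact if_congr (map_eq_one_iff _ (Monoid.CoprodI.of_injective j)) rfl rfl
  exact congrArg (fun f => f x) this

/-- The copies of the group algebra have the joint moments that the moment-cumulant formula
prescribes. By multilinearity it suffices to consider group elements. -/
theorem apply_prod_colourHom [DecidableEq (Monoid.CoprodI (fun _ : J => C))]
    {U : Monoid.CoprodI (fun _ : J => C) →* A} {φ : A →ₗ[ℂ] ℂ}
    (hφ : ∀ g, φ (U g) = if g = 1 then 1 else 0) {m : ℕ} (j : Fin m → J)
    (a : Fin m → MonoidAlgebra ℂ C) :
    φ (List.ofFn fun r => colourHom U (j r) (a r)).prod = ncMoment (groupTrace C) j a := by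
  classical
  have : φ.compMultilinearMap ((MultilinearMap.mkPiAlgebraFin ℂ m A).compLinearMap
      fun r => (colourHom U (j r)).toLinearMap) = ncMomentMultilinear (groupTrace C) j := by
    refine Module.Basis.ext_multilinear (fun _ => MonoidAlgebra.basis C ℂ) fun t => ?_
    have hb : ∀ s : C, MonoidAlgebra.basis C ℂ s = MonoidAlgebra.of ℂ C s := by
      intro s
      simp
    change φ (MultilinearMap.mkPiAlgebraFin ℂ m A fun r => colourHom U (j r) _) = ncMoment _ _ _
    simp only [hb, colourHom_of, MultilinearMap.mkPiAlgebraFin_apply]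
    rw [show (fun r => U (letter (j r) (t r))) = U ∘ fun r => letter (j r) (t r) from rfl,
      ← List.map_ofFn, ← map_list_prod, hφ, ncMoment_group]
    unfold ncMoment blockProd
    refine Finset.sum_congr rfl fun σ _ => congrArg _ (Finset.prod_congr rfl fun V _ => ?_)
    rw [← map_prod, MonoidAlgebra.of_apply, groupTrace_single]
  exact congrArg (fun f => f a) this

end Moments

/-! ### The left regular representation -/

section RegularRepresentation

variable (G : Type) [Group G]

/-- The Hilbert space `ℓ²(G)`. -/
abbrev EllTwo : Type := lp (fun _ : G => ℂ) 2

variable {G}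

/-- Left translation `(g f)(x) = f(g⁻¹ x)`, as an isometry of `ℓ²(G)`. -/
def leftTranslation (g : G) : EllTwo G →ₗᵢ[ℂ] EllTwo G where
  toFun f := ⟨fun x => f (g⁻¹ * x), (memℓp_gen_iff (by simp)).2
    (((Equiv.mulLeft g⁻¹).summable_iff (f := fun x => ‖f x‖ ^ (2 : ℝ≥0∞).toReal)).2
      ((memℓp_gen_iff (by simp)).1 (lp.memℓp f)))⟩
  map_add' _ _ := rfl
  map_smul' _ _ := rfl
  norm_map' f := by
    change ‖(⟨fun x => f (g⁻¹ * x), _⟩ : EllTwo G)‖ = _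
    rw [lp.norm_eq_tsum_rpow (by simp), lp.norm_eq_tsum_rpow (by simp)]
    congr 1
    exact (Equiv.mulLeft g⁻¹).tsum_eq fun x => ‖f x‖ ^ (2 : ℝ≥0∞).toReal

theorem leftTranslation_apply (g : G) (f : EllTwo G) (x : G) :
    leftTranslation g f x = f (g⁻¹ * x) := rfl

variable (G) in
/-- The left regular representation. -/
def leftRegular : G →* (EllTwo G →L[ℂ] EllTwo G) where
  toFun g := (leftTranslation g).toContinuousLinearMap
  map_one' := by
    ext f x
    simp [leftTranslation_apply]
  map_mul' g h := by
    ext f x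
    simp [leftTranslation_apply, mul_assoc]

theorem leftRegular_apply (g : G) (f : EllTwo G) (x : G) :
    leftRegular G g f x = f (g⁻¹ * x) := rfl

theorem star_leftRegular (g : G) : star (leftRegular G g) = leftRegular G g⁻¹ := by
  have h1 : star (leftRegular G g) * leftRegular G g = 1 := by
    rw [ContinuousLinearMap.star_eq_adjoint]
    exact (leftTranslation g).adjoint_comp_self
  calc star (leftRegular G g) = star (leftRegular G g) * (leftRegular G g * leftRegular G g⁻¹) := by
        rw [← map_mul, mul_inv_cancel, map_one, mul_one]
    _ = leftRegular G g⁻¹ := by rw [← mul_assoc, h1, one_mul]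

variable (G) in
/-- The vector state of the point mass at the unit. -/
def vacuumState [DecidableEq G] : (EllTwo G →L[ℂ] EllTwo G) →ₗ[ℂ] ℂ where
  toFun T := inner ℂ (lp.single 2 (1 : G) (1 : ℂ)) (T (lp.single 2 (1 : G) (1 : ℂ)))
  map_add' S T := by simp
  map_smul' c T := by simp

theorem isState_vacuumState [DecidableEq G] : IsState (vacuumState G) where
  map_one := by
    simp [vacuumState]
  nonneg T := by
    rw [vacuumState, LinearMap.coe_mk, AddHom.coe_mk, ContinuousLinearMap.star_eq_adjoint,
      mul_apply_eq_comp, ContinuousLinearMap.adjoint_inner_right, inner_self_eq_norm_sq_to_K,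
      ← RCLike.ofReal_pow]
    exact Complex.zero_le_real.2 (sq_nonneg _)

theorem vacuumState_leftRegular [DecidableEq G] (g : G) :
    vacuumState G (leftRegular G g) = if g = 1 then 1 else 0 := by
  rw [vacuumState, LinearMap.coe_mk, AddHom.coe_mk, lp.inner_single_left, leftRegular_apply]
  by_cases h : g = 1
  · subst h; simp
  · simp [h, lp.single_apply]

variable (G) in
/-- Every group has a unitary representation in a C⋆-algebra with a state that is the canonical
trace on the group elements. -/
theorem exists_traced_representation [DecidableEq G] :
    ∃ (A : Type) (_ : CStarAlgebra A) (U : G →* A) (φ : A →ₗ[ℂ] ℂ),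
      (∀ g, star (U g) = U g⁻¹) ∧ IsState φ ∧ ∀ g, φ (U g) = if g = 1 then 1 else 0 :=
  ⟨EllTwo G →L[ℂ] EllTwo G, inferInstance, leftRegular G, vacuumState G, star_leftRegular,
    isState_vacuumState, vacuumState_leftRegular⟩

end RegularRepresentation

/-! ### The spectral projections of a cyclic group -/

section Projections

variable {n : ℕ} [NeZero n]

/-- The spectral projection `(1/n) ∑ t, exp(-2πi t i / n) g ^ t` of the generator `g` of `ℤ/n` for
the eigenvalue `exp(2πi i / n)`, in the group algebra. -/
def cyclicProj (i : Fin n) : MonoidAlgebra ℂ (Multiplicative (ZMod n)) :=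
  ∑ t : ZMod n, ((n : ℂ)⁻¹ * ZMod.stdAddChar (-(t * ((i : ℕ) : ZMod n)))) •
    MonoidAlgebra.of ℂ _ (Multiplicative.ofAdd t)

theorem natCast_fin_bijective : Function.Bijective fun i : Fin n => ((i : ℕ) : ZMod n) := by
  rw [Fintype.bijective_iff_injective_and_card, ZMod.card, Fintype.card_fin]
  refine ⟨fun i i' h => ?_, rfl⟩
  have := (ZMod.natCast_eq_natCast_iff' _ _ _).1 h
  rw [Nat.mod_eq_of_lt i.2, Nat.mod_eq_of_lt i'.2] at this
  exact Fin.ext this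

theorem sum_stdAddChar_mul (b : ZMod n) :
    ∑ t : ZMod n, ZMod.stdAddChar (t * b) = if b = 0 then (n : ℂ) else 0 := by
  rw [AddChar.sum_mulShift b (ZMod.isPrimitive_stdAddChar n), ZMod.card]
  simp

/-- The group elements act on the spectral projections by characters. -/
theorem of_mul_cyclicProj (s : ZMod n) (i : Fin n) :
    MonoidAlgebra.of ℂ _ (Multiplicative.ofAdd s) * cyclicProj i =
      (ZMod.stdAddChar (s * ((i : ℕ) : ZMod n)) : ℂ) • cyclicProj i := by
  unfold cyclicProj
  rw [Finset.mul_sum, Finset.smul_sum]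
  refine Fintype.sum_equiv (Equiv.addLeft s) _ _ fun t => ?_
  rw [mul_smul_comm, ← map_mul, smul_smul, Equiv.coe_addLeft, ← ofAdd_add,
    mul_left_comm, ← AddChar.map_add_eq_mul]
  congr 3
  ring_nf

theorem cyclicProj_mul (i i' : Fin n) :
    cyclicProj i * cyclicProj i' = if i = i' then cyclicProj i else 0 := by
  have hn : (n : ℂ) ≠ 0 := Nat.cast_ne_zero.2 (NeZero.ne n)
  conv_lhs => arg 1; unfold cyclicProj
  simp only [Finset.sum_mul, smul_mul_assoc, of_mul_cyclicProj, smul_smul, mul_assoc,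
    ← AddChar.map_add_eq_mul]
  rw [← Finset.sum_smul, ← Finset.mul_sum]
  simp only [← mul_neg, ← mul_add]
  rw [sum_stdAddChar_mul]
  by_cases h : i = i'
  · subst h
    simp [hn]
  · rw [if_neg h, if_neg, mul_zero, zero_smul]
    intro h0
    exact h (natCast_fin_bijective.1 (neg_add_eq_zero.1 h0))

theorem sum_cyclicProj : ∑ i : Fin n, cyclicProj i = 1 := by
  have hn : (n : ℂ) ≠ 0 := Nat.cast_ne_zero.2 (NeZero.ne n)
  unfold cyclicProj
  rw [Finset.sum_comm]
  have h : ∀ t : ZMod n, ∑ i : Fin n, (n : ℂ)⁻¹ * ZMod.stdAddChar (-(t * ((i : ℕ) : ZMod n))) =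
      if t = 0 then 1 else 0 := by
    intro t
    rw [← Finset.mul_sum, natCast_fin_bijective.sum_comp
      (fun x : ZMod n => (ZMod.stdAddChar (-(t * x)) : ℂ))]
    simp only [mul_comm t, ← mul_neg]
    rw [sum_stdAddChar_mul]
    by_cases ht : t = 0 <;> simp [ht, hn]
  simp only [← Finset.sum_smul, h]
  simp [MonoidAlgebra.one_def]

theorem groupTrace_cyclicProj (i : Fin n) : groupTrace _ (cyclicProj i) = (n : ℂ)⁻¹ := by
  unfold cyclicProj
  simp [groupTrace_single]

theorem prod_cyclicProj {ι : Type} {s : Finset ι} (i : ι → Fin n) {a : ι} (ha : a ∈ s) :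
    ∏ r ∈ s, cyclicProj (i r) = if ∀ b ∈ s, i b = i a then cyclicProj (i a) else 0 := by
  classical
  split_ifs with h
  · rw [Finset.prod_congr rfl fun b hb => by rw [h b hb], Finset.prod_const]
    have hid : IsIdempotentElem (cyclicProj (i a)) := by
      rw [IsIdempotentElem, cyclicProj_mul, if_pos rfl]
    exact hid.pow_eq (Finset.card_pos.2 ⟨a, ha⟩).ne'
  · push Not at h
    obtain ⟨b, hb, hne⟩ := h
    have hba : b ≠ a := fun h => hne (by rw [h])
    rw [← Finset.mul_prod_erase _ _ ha, ← Finset.mul_prod_erase _ _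
      (Finset.mem_erase.2 ⟨hba, hb⟩), ← mul_assoc, cyclicProj_mul, if_neg (Ne.symm hne), zero_mul]

open Classical in
/-- The block product is `n ^ (-|σ|)` if the projections agree on every block of `σ`; otherwise some
block has two orthogonal factors. -/
theorem blockProd_cyclicProj {m : ℕ} (i : Fin m → Fin n) (σ : Part m) :
    blockProd (groupTrace _) (fun r => cyclicProj (i r)) σ =
      if σ ≤ kerPart i then (n : ℂ) ^ (-(σ.parts.card : ℤ)) else 0 := by
  split_ifs with h
  · rw [blockProd, Finset.prod_congr rfl (g := fun _ => (n : ℂ)⁻¹), Finset.prod_const, zpow_neg,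
      zpow_natCast, inv_pow]
    intro V hV
    obtain ⟨a, ha⟩ := σ.nonempty_of_mem_parts hV
    rw [prod_cyclicProj i ha, if_pos, groupTrace_cyclicProj]
    intro b hb
    refine (le_kerPart_iff.1 h a b ?_).symm
    change b ∈ σ.part a
    rwa [σ.part_eq_of_mem hV ha]
  · rw [le_kerPart_iff] at h
    push Not at h
    obtain ⟨a, b, hab, hne⟩ := h
    rw [blockProd, Finset.prod_eq_zero (σ.part_mem.2 (Finset.mem_univ a))]
    rw [prod_cyclicProj i (σ.mem_part (Finset.mem_univ a)), if_neg, map_zero]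
    exact fun h => hne (h b hab).symm

variable {J A : Type} [CStarAlgebra A]

theorem isStarProjection_colourHom {U : Monoid.CoprodI (fun _ : J => Multiplicative (ZMod n)) →* A}
    (hU : ∀ g, star (U g) = U g⁻¹) (j : J) (i : Fin n) :
    IsStarProjection (colourHom U j (cyclicProj i)) := by
  refine ⟨?_, ?_⟩
  · rw [IsIdempotentElem, ← map_mul, cyclicProj_mul, if_pos rfl]
  · rw [IsSelfAdjoint]
    unfold cyclicProj
    simp only [map_sum, map_smul, star_sum, star_smul, colourHom, MonoidAlgebra.lift_of,
      MonoidHom.comp_apply, hU]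
    refine Fintype.sum_equiv (Equiv.neg _) _ _ fun t => ?_
    rw [← map_inv, ← ofAdd_neg, Equiv.neg_apply]
    congr 1
    rw [star_mul', star_inv₀, star_natCast, neg_mul, neg_neg, AddChar.map_neg_eq_conj]
    exact congrArg _ (Complex.conj_conj _)

end Projections

/-! ### Block diagonal matrices -/

theorem blockRow_injective {k n : ℕ} (j : Fin k) :
    Function.Injective (blockRow (n := n) j) := fun i i' h => by
  have : (j : ℕ) * n + i = j * n + i' := congrArg Fin.val h
  exact Fin.ext (by omega)

theorem inBlock_iff {k n : ℕ} {l : Fin (k * n)} {j : Fin k} :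
    InBlock l j ↔ ∃ i, blockRow j i = l := by
  constructor
  · rintro ⟨h1, h2⟩
    rw [Nat.succ_mul] at h2
    exact ⟨⟨l - j * n, by omega⟩, Fin.ext (by simp only [blockRow]; omega)⟩
  · rintro ⟨i, rfl⟩
    refine ⟨Nat.le_add_right _ _, ?_⟩
    rw [Nat.succ_mul]
    exact Nat.add_lt_add_left i.isLt _

theorem InBlock.lt_of_lt {k n : ℕ} {l l' : Fin (k * n)} {j j' : Fin k} (h : InBlock l j)
    (h' : InBlock l' j') (hj : j < j') : l < l' :=
  Fin.lt_def.2 <| h.2.trans_le <| (Nat.mul_le_mul_right n (Nat.succ_le_of_lt hj)).trans h'.1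

/-- The matrix with `kn` rows and `k` columns whose `j`-th column is `p · j` in the `j`-th block of
`n` consecutive rows and zero elsewhere. -/
def blockDiagonal {k n : ℕ} {A : Type} [CStarAlgebra A] (p : Fin n → Fin k → A)
    (l : Fin (k * n)) (j : Fin k) : A :=
  ∑ i, if blockRow j i = l then p i j else 0

section BlockDiagonal

variable {k n : ℕ} {A : Type} [CStarAlgebra A] (p : Fin n → Fin k → A)

theorem blockDiagonal_blockRow (i : Fin n) (j : Fin k) :
    blockDiagonal p (blockRow j i) j = p i j := by
  simp [blockDiagonal, (blockRow_injective j).eq_iff]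

theorem blockDiagonal_eq_zero {l : Fin (k * n)} {j : Fin k} (h : ¬ InBlock l j) :
    blockDiagonal p l j = 0 :=
  Finset.sum_eq_zero fun i _ => if_neg fun hi => h (inBlock_iff.2 ⟨i, hi⟩)

theorem isIncreasingMatrix_blockDiagonal {p : Fin n → Fin k → A}
    (hp : ∀ i j, IsStarProjection (p i j)) (hsum : ∀ j, ∑ i, p i j = 1) :
    IsIncreasingMatrix (blockDiagonal p) where
  isStarProjection l j := by
    by_cases h : InBlock l j
    · obtain ⟨i, rfl⟩ := inBlock_iff.1 h
      rw [blockDiagonal_blockRow]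
      exact hp i j
    · rw [blockDiagonal_eq_zero p h]
      exact .zero _
  sum_eq_one j := by
    unfold blockDiagonal
    rw [Finset.sum_comm, ← hsum j]
    simp
  mul_eq_zero l l' j j' hj hl := by
    by_cases h : InBlock l j
    · by_cases h' : InBlock l' j'
      · exact absurd hl (not_le.2 (h.lt_of_lt h' hj))
      · rw [blockDiagonal_eq_zero p h', mul_zero]
    · rw [blockDiagonal_eq_zero p h, zero_mul]

end BlockDiagonal

/-! ### Free independence and the moments of the projections -/

section Freeness

variable {J C A : Type} [CommGroup C] [CStarAlgebra A]

theorem exists_colourHom_eq_of_mem_adjoin {U : Monoid.CoprodI (fun _ : J => C) →* A}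
    {j : J} {s : Set A} (hs : ∀ a ∈ s, IsSelfAdjoint a) (hs' : s ⊆ Set.range (colourHom U j))
    {a : A}
    (ha : a ∈ StarAlgebra.adjoin ℂ s) : ∃ x, colourHom U j x = a := by
  have hle : Algebra.adjoin ℂ (s ∪ star s) ≤ (colourHom U j).range := by
    refine Algebra.adjoin_le (Set.union_subset hs' fun b hb => hs' ?_)
    rw [← star_star b, (hs _ hb).star_eq]
    exact hb
  exact hle ha

/-- The copies of the group algebra are free: after pulling back to the group algebra, moments of
centered alternating words vanish by `ncMoment_eq_zero`. -/
theorem freelyIndependent_colourHom [DecidableEq (Monoid.CoprodI (fun _ : J => C))]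
    {U : Monoid.CoprodI (fun _ : J => C) →* A} {φ : A →ₗ[ℂ] ℂ}
    (hφ : ∀ g, φ (U g) = if g = 1 then 1 else 0) {s : J → Set A}
    (hs : ∀ j, ∀ a ∈ s j, IsSelfAdjoint a) (hs' : ∀ j, s j ⊆ Set.range (colourHom U j)) :
    FreelyIndependent φ s := by
  intro m j a hj ha h0
  choose x hx using fun r => exists_colourHom_eq_of_mem_adjoin (hs _) (hs' _) (ha r)
  obtain rfl : (fun r => colourHom U (j r) (x r)) = a := funext hx
  rw [apply_prod_colourHom hφ]
  refine ncMoment_eq_zero hj fun r => ?_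
  rw [← apply_colourHom hφ (j r)]
  exact h0 r

end Freeness

theorem sum_ncBelow {m : ℕ} {J : Type} (j : Fin m → J) (f : NC m → ℂ) :
    ∑ σ : NCBelow j, f σ.1 = ∑ σ : NC m with σ.1 ≤ kerPart j, f σ :=
  (Finset.sum_subtype _ (by simp) f).symm

/-- The double sum of the moment-cumulant formula arises from `ncMoment` by exchanging the sums over
`σ` and `π`; the terms with `σ` not below `ker i` vanish. -/
theorem ncMoment_cyclicProj {m k n : ℕ} [NeZero n] (j : Fin m → Fin k) (i : Fin m → Fin n) :
    ncMoment (groupTrace _) j (fun r => cyclicProj (i r)) =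
      ∑ π : NC m with π.1 ≤ kerPart j,
        ∑ σ : NC m with σ.1 ≤ π.1 ⊓ kerPart i,
          ((IncidenceAlgebra.mu ℤ σ π : ℤ) : ℂ) * (n : ℂ) ^ (-(σ.1.parts.card : ℤ)) := by
  classical
  rw [← sum_ncBelow j fun π => ∑ σ : NC m with σ.1 ≤ π.1 ⊓ kerPart i,
    ((IncidenceAlgebra.mu ℤ σ π : ℤ) : ℂ) * (n : ℂ) ^ (-(σ.1.parts.card : ℤ))]
  have inner : ∀ π : NCBelow j, (∑ σ : NC m with σ.1 ≤ π.1.1 ⊓ kerPart i,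
      ((IncidenceAlgebra.mu ℤ σ π.1 : ℤ) : ℂ) * (n : ℂ) ^ (-(σ.1.parts.card : ℤ))) =
      ∑ σ : NCBelow j, if σ ≤ π then ((IncidenceAlgebra.mu ℤ σ.1 π.1 : ℤ) : ℂ) *
        blockProd (groupTrace _) (fun r => cyclicProj (i r)) σ.1.1 else 0 := by
    intro π
    refine Eq.trans ?_ (sum_ncBelow j fun σ => if σ ≤ π.1 then
      ((IncidenceAlgebra.mu ℤ σ π.1 : ℤ) : ℂ) *
        blockProd (groupTrace _) (fun r => cyclicProj (i r)) σ.1 else 0).symm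
    rw [Finset.sum_filter, Finset.sum_filter]
    refine Finset.sum_congr rfl fun σ _ => ?_
    rw [blockProd_cyclicProj]
    by_cases h1 : σ.1 ≤ π.1.1
    · have h2 : σ.1 ≤ kerPart j := h1.trans π.2
      have h3 : σ ≤ π.1 := h1
      by_cases h4 : σ.1 ≤ kerPart i <;> simp [h1, h2, h3, h4]
    · have h3 : ¬ σ ≤ π.1 := h1
      simp [h1, h3]
  simp only [inner, ncMoment, ncCoeff, Finset.sum_mul]
  simp only [Finset.sum_filter]
  exact Finset.sum_comm

end QuantumIncreasing
end

open QuantumIncreasing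
theorem mainTheorem4 (k n : ℕ) (hn : 1 ≤ n) :
    ∃ ψ : Ai k (k * n) →ₗ[ℂ] ℂ, IsState ψ ∧
      -- vanishing of `ψ` on monomials with an entry outside its block
      (∀ (m : ℕ) (l : Fin m → Fin (k * n)) (j : Fin m → Fin k),
        ¬ (∀ r, InBlock (l r) (j r)) →
        ψ (List.ofFn fun r => (Ai.gen (l r) (j r) : Ai k (k * n))).prod = 0) ∧
      -- the value of `ψ` on the remaining monomials
      (∀ (m : ℕ) (j : Fin m → Fin k) (i : Fin m → Fin n),
        ψ (List.ofFn fun r => (Ai.gen (blockRow (j r) (i r)) (j r) : Ai k (k * n))).prod =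
          ∑ π : NC m with π.1 ≤ kerPart j,
            ∑ σ : NC m with σ.1 ≤ π.1 ⊓ kerPart i,
              ((IncidenceAlgebra.mu ℤ σ π : ℤ) : ℂ) * (n : ℂ) ^ (-(σ.1.parts.card : ℤ))) ∧
      -- `ψ` comes from `k` free families of `n` projections of trace `1 / n`
      (∃ (A : Type) (_ : CStarAlgebra A) (φ : A →ₗ[ℂ] ℂ) (p : Fin n → Fin k → A)
          (h : Ai k (k * n) →⋆ₐ[ℂ] A),
        IsState φ ∧
        (∀ i j, IsStarProjection (p i j)) ∧
        (∀ j, ∑ i, p i j = 1) ∧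
        (∀ i j, φ (p i j) = 1 / (n : ℂ)) ∧
        FreelyIndependent φ (fun j : Fin k => Set.range fun i => p i j) ∧
        (∀ i j, h (Ai.gen (blockRow j i) j) = p i j) ∧
        (∀ l j, ¬ InBlock l j → h (Ai.gen l j) = 0) ∧
        ∀ x, ψ x = φ (h x)) := by
  classical
  have : NeZero n := ⟨by omega⟩
  let G := Monoid.CoprodI (fun _ : Fin k => Multiplicative (ZMod n))
  obtain ⟨A, _, U, φ, hU, hφstate, hφ⟩ := exists_traced_representation G
  let p : Fin n → Fin k → A := fun i j => colourHom U j (cyclicProj i)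
  have hproj : ∀ i j, IsStarProjection (p i j) := fun i j =>
    isStarProjection_colourHom hU j i
  have hsum : ∀ j, ∑ i, p i j = 1 := fun j => by
    simp only [p]
    rw [← map_sum, sum_cyclicProj, map_one]
  obtain ⟨h, hgen, -⟩ := Ai.existsUnique_lift (isIncreasingMatrix_blockDiagonal hproj hsum)
  have hblock : ∀ i j, h (Ai.gen (blockRow j i) j) = p i j := fun i j => by
    rw [hgen, blockDiagonal_blockRow]
  have hzero : ∀ l j, ¬ InBlock l j → h (Ai.gen l j) = 0 := fun l j hl => by
    rw [hgen, blockDiagonal_eq_zero p hl]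
  refine ⟨φ ∘ₗ h.toAlgHom.toLinearMap, ⟨?_, fun a => ?_⟩, ?_, ?_, _, inferInstance, φ, p, h,
    hφstate, hproj, hsum, ?_, ?_, hblock, hzero, fun _ => rfl⟩
  · change φ (h 1) = 1
    rw [map_one, hφstate.map_one]
  · have := hφstate.nonneg (h a)
    rwa [← map_star, ← map_mul] at this
  · intro m l j hlj
    push Not at hlj
    obtain ⟨r, hr⟩ := hlj
    change φ (h _) = 0
    rw [map_list_prod, List.map_ofFn, List.prod_eq_zero, map_zero]
    rw [List.mem_ofFn']
    exact ⟨r, hzero _ _ hr⟩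
  · intro m j i
    change φ (h _) = _
    rw [map_list_prod, List.map_ofFn]
    have hp : (h ∘ fun r => (Ai.gen (blockRow (j r) (i r)) (j r) : Ai k (k * n))) =
        fun r => colourHom U (j r) (cyclicProj (i r)) := funext fun r => hblock _ _
    rw [hp, apply_prod_colourHom hφ, ncMoment_cyclicProj]
  · intro i j
    rw [one_div, ← groupTrace_cyclicProj i]
    exact apply_colourHom hφ j _
  · refine freelyIndependent_colourHom hφ ?_ ?_
    · rintro j _ ⟨i, rfl⟩
      exact (hproj i j).isSelfAdjoint
    · rintro j _ ⟨i, rfl⟩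
      exact ⟨_, rfl⟩
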